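/- Let $\log$ denote the logarithm to base $2$. For $z\in\mathbb{F}_2^N$ let $|z|$ be its Hamming weight, and for $\epsilon\in(0,1)$ let $P_\epsilon$ be the probability distribution on $\mathbb{F}_2^N$ given by $P_\epsilon(z)=\epsilon^{|z|}(1-\epsilon)^{N-|z|}$ (the noise of the binary symmetric channel). A linear code, i.e. a linear subspace $C\subseteq\mathbb{F}_2^N$, is called transitive if for all $i,j\in\{1,\dots,N\}$ there is a permutation $\pi$ of $\{1,\dots,N\}$ with $\pi(i)=j$ such that $(v_{\pi(1)},\dots,v_{\pi(N)})\in C$ for every $(v_1,\dots,v_N)\in C$. Theorem. Fix $\epsilon\in(0,\frac12)$, $\eta\in(0,1)$ and an integer $N>\left(\frac{5}{\epsilon}\right)^{20}$. Then for every transitive linear code $C\subseteq\mathbb{F}_2^N$ of dimension $\dim C=\eta N$ there exists a function $T$ mapping every $x\in\mathbb{F}_2^N$ to a subset $T(x)\subseteq C$ of size $$|T(x)|\le N^7\cdot 2^{(\epsilon N+N^{3/4})\log\frac{e^4}{1-\eta}},$$ with the property that for every codeword $c\in C$, $$\Pr_{\rho\sim P_\epsilon}\big[c\notin T(c+\rho)\big]\le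 e^{-\frac{\sqrt N}{3\epsilon}}+\frac{1}{\sqrt N}.$$ -/

import Mathlib

/-- A set `C ⊆ F₂^N` is transitive if for all coordinates `i`, `j` there is a permutation `π` of
the coordinates with `π i = j` such that `(v_{π(1)}, …, v_{π(N)}) ∈ C` for every `v ∈ C`. -/
def IsTransitiveCode {N : ℕ} (C : Set (Fin N → ZMod 2)) : Prop :=
  ∀ i j : Fin N, ∃ π : Equiv.Perm (Fin N),
    π i = j ∧ ∀ v ∈ C, (fun k => v (π k)) ∈ C

/-- The `ε`-noisy distribution `P_ε(z) = ε^|z| (1 - ε)^(N - |z|)` on `F₂^N`, where `|z|` is the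
Hamming weight. -/
noncomputable def noisyDist {N : ℕ} (ε : ℝ) (z : Fin N → ZMod 2) : ℝ :=
  ε ^ hammingNorm z * (1 - ε) ^ (N - hammingNorm z)

/-- The probability `Pr_{ρ ∼ P_ε}[ρ ∈ E]` of an event `E ⊆ F₂^N`. -/
noncomputable def noisyProb {N : ℕ} (ε : ℝ) (E : Set (Fin N → ZMod 2)) : ℝ :=
  ∑ z : Fin N → ZMod 2, E.indicator (noisyDist ε) z

/-! Decode to the codewords `c` within distance `r = εN + N^(3/4)` of `x` such that few words of `x
+ C` have the weight of `c + x`. Such lists are short. The true codeword is missed only if the noise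
is heavier than `r` (Chernoff) or its coset holds many words of its weight (Markov).

Markov needs a bound on the number of pairs `(y, z)` of weight `w` with `y + z ∈ C`. Detecting `C`
by characters of `D = C^⊥` and replacing words of weight `w` by `w`-tuples of basis vectors bounds
this number by `(w!)^(-2) |D|^(-1) ∑_{v ∈ D} (N - 2|v|)^(2w)` (`sum_cosetWeightCount_mul_le`).

Transitivity passes to `D` and controls its weights (`card_weightClass_mul_exp_le`): on the words of
weight `m` every coordinate has mean sign `x = (N - 2m)/N`, while the `K = dim D` coordinates of an
information set determine the word. An exponential moment then shows that at most `2^K e^(-K x²/2)`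
words have weight `m`, which offsets the size of `(N x)^(2w)` (`sum_code_pow_le`). -/

/-! ### Signs and tuples of basis vectors. -/

/-- The nontrivial character of `F₂`, with values `±1`. -/
noncomputable def binarySign (a : ZMod 2) : ℝ := if a = 0 then 1 else -1

@[simp] theorem binarySign_zero : binarySign 0 = 1 := by simp [binarySign]

theorem zmod_two_eq_zero_or_one (a : ZMod 2) : a = 0 ∨ a = 1 := by
  revert a; decide

@[simp] theorem binarySign_one : binarySign 1 = -1 := by simp [binarySign]

theorem binarySign_add (a b : ZMod 2) :
    binarySign (a + b) = binarySign a * binarySign b := by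
  rcases zmod_two_eq_zero_or_one a with rfl | rfl <;>
  rcases zmod_two_eq_zero_or_one b with rfl | rfl <;>
  simp [show (1 : ZMod 2) + 1 = 0 from rfl]

theorem binary_add_self {ι : Type*} (z : ι → ZMod 2) : z + z = 0 := by
  ext i
  exact CharTwo.add_self_eq_zero _

/-- A sum of a character over a binary linear code is nonnegative. -/
theorem sum_binarySign_nonneg {N : ℕ} (D : Submodule (ZMod 2) (Fin N → ZMod 2))
    [Fintype D] (y : Fin N → ZMod 2) :
    0 ≤ ∑ v : D, binarySign (v.1 ⬝ᵥ y) := by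
  by_cases h : ∃ u : D, u.1 ⬝ᵥ y = 1
  · obtain ⟨u, hu⟩ := h
    -- Translation by `u` permutes `D` and flips every sign, so the sum vanishes.
    have key : ∑ v : D, binarySign (v.1 ⬝ᵥ y) = -∑ v : D, binarySign (v.1 ⬝ᵥ y) := by
      rw [← Finset.sum_neg_distrib]
      refine Fintype.sum_equiv (Equiv.addRight u) _ _ fun v => ?_
      simp [add_dotProduct, binarySign_add, hu]
    linarith
  · push Not at h
    refine Finset.sum_nonneg fun v _ => ?_
    rcases zmod_two_eq_zero_or_one (v.1 ⬝ᵥ y) with h0 | h1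
    · simp [h0]
    · exact absurd h1 (h v)

/-- The number of `w`-tuples of standard basis vectors of `F₂^N` with sum `y`. -/
noncomputable def basisTupleCount {N : ℕ} : ℕ → (Fin N → ZMod 2) → ℝ
  | 0, y => if y = 0 then 1 else 0
  | w + 1, y => ∑ j, basisTupleCount w (y + Pi.single j 1)

theorem basisTupleCount_nonneg {N : ℕ} (w : ℕ) (y : Fin N → ZMod 2) :
    0 ≤ basisTupleCount w y := by
  induction w generalizing y with
  | zero => unfold basisTupleCount; split_ifs <;> norm_num
  | succ w ih => exact Finset.sum_nonneg fun j _ => ih _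

theorem hammingNorm_add_single {N : ℕ} (y : Fin N → ZMod 2) (j : Fin N) (hj : y j ≠ 0) :
    hammingNorm (y + Pi.single j 1) + 1 = hammingNorm y := by
  have h1 : y j = 1 := (zmod_two_eq_zero_or_one _).resolve_left hj
  unfold hammingNorm
  rw [← Finset.card_erase_add_one (s := {i | y i ≠ 0}) (a := j) (by simp [hj])]
  congr 2
  ext i
  by_cases hi : i = j
  · subst hi; simp [h1]; rfl
  · simp [hi]

/-- The orderings of the support of `y` are already `w!` such tuples. -/
theorem factorial_le_basisTupleCount {N : ℕ} (w : ℕ) (y : Fin N → ZMod 2)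
    (hy : hammingNorm y = w) : (w.factorial : ℝ) ≤ basisTupleCount w y := by
  induction w generalizing y with
  | zero => simp [basisTupleCount, hammingNorm_eq_zero.mp hy]
  | succ w ih =>
    unfold basisTupleCount
    calc ((w + 1).factorial : ℝ) = ∑ j with y j ≠ 0, (w.factorial : ℝ) := by
          have : Finset.card {j | y j ≠ 0} = w + 1 := hy
          rw [Finset.sum_const, this, Nat.factorial_succ]; push_cast; simp
      _ ≤ ∑ j with y j ≠ 0, basisTupleCount w (y + Pi.single j 1) := by
          refine Finset.sum_le_sum fun j hj => ih _ ?_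
          have := hammingNorm_add_single y j (by simpa using hj)
          omega
      _ ≤ _ := Finset.sum_le_sum_of_subset_of_nonneg (Finset.filter_subset _ _)
          fun j _ _ => basisTupleCount_nonneg _ _

/-- Expanding the power, a tuple of coordinates contributes the sign of `v` paired with the sum of
its basis vectors; the tuples are grouped by that sum. -/
theorem sum_binarySign_pow {N : ℕ} (w : ℕ) (v : Fin N → ZMod 2) :
    (∑ i, binarySign (v i)) ^ w = ∑ y, basisTupleCount w y * binarySign (v ⬝ᵥ y) := by
  induction w with
  | zero => simp [basisTupleCount]
  | succ w ih =>
    simp_rw [basisTupleCount, Finset.sum_mul]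
    rw [Finset.sum_comm, pow_succ, ih, Finset.mul_sum]
    refine Finset.sum_congr rfl fun j _ => ?_
    rw [Finset.sum_mul]
    refine Fintype.sum_equiv (Equiv.addRight (Pi.single j 1)) _ _ fun y => ?_
    simp [add_assoc, binary_add_self, dotProduct_add, binarySign_add]
    ring

/-! ### Dual codes and information sets. -/

/-- The orthogonal complement of a binary linear code for the standard bilinear form. -/
noncomputable def dualCode {N : ℕ} (C : Submodule (ZMod 2) (Fin N → ZMod 2)) :
    Submodule (ZMod 2) (Fin N → ZMod 2) :=
  (C.map (dotProductEquiv (ZMod 2) (Fin N)).toLinearMap).dualCoannihilator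

theorem mem_dualCode {N : ℕ} {C : Submodule (ZMod 2) (Fin N → ZMod 2)} {v : Fin N → ZMod 2} :
    v ∈ dualCode C ↔ ∀ c ∈ C, c ⬝ᵥ v = 0 := by
  unfold dualCode
  rw [Submodule.mem_dualCoannihilator]
  refine ⟨fun h c hc => h _ (Submodule.mem_map_of_mem hc), ?_⟩
  rintro h _ ⟨c, hc, rfl⟩
  exact h c hc

theorem finrank_add_finrank_dualCode {N : ℕ} (C : Submodule (ZMod 2) (Fin N → ZMod 2)) :
    Module.finrank (ZMod 2) C + Module.finrank (ZMod 2) (dualCode C) = N := by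
  have h := Subspace.finrank_add_finrank_dualCoannihilator_eq
    (C.map (dotProductEquiv (ZMod 2) (Fin N)).toLinearMap)
  rw [LinearEquiv.finrank_map_eq (dotProductEquiv (ZMod 2) (Fin N)) C] at h
  rw [Module.finrank_fin_fun] at h
  exact h

/-- The pairing is permutation invariant, so the inverse of a permutation preserving `C` preserves
the dual. -/
theorem IsTransitiveCode.dualCode {N : ℕ} {C : Submodule (ZMod 2) (Fin N → ZMod 2)}
    (hC : IsTransitiveCode (C : Set (Fin N → ZMod 2))) :
    IsTransitiveCode (dualCode C : Set (Fin N → ZMod 2)) := by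
  intro i j
  obtain ⟨π, hπ, h⟩ := hC j i
  refine ⟨π.symm, by rw [← hπ]; simp, fun v hv => ?_⟩
  refine mem_dualCode.mpr fun c hc => ?_
  rw [← mem_dualCode.mp hv _ (h c hc)]
  exact Fintype.sum_equiv π.symm _ _ fun k => by simp

/-- Every binary linear code has an information set: as many coordinates as the dimension, which
determine the codewords. -/
theorem exists_information_set {N : ℕ} (D : Submodule (ZMod 2) (Fin N → ZMod 2)) :
    ∃ I : Finset (Fin N), I.card = Module.finrank (ZMod 2) D ∧
      ∀ u ∈ D, ∀ v ∈ D, (∀ i ∈ I, u i = v i) → u = v := by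
  classical
  let f : Fin N → Module.Dual (ZMod 2) D := fun i => (LinearMap.proj i).comp D.subtype
  obtain ⟨κ, a, ha, hspan, hli⟩ := exists_linearIndependent' (ZMod 2) f
  have : Fintype κ := Fintype.ofInjective a ha
  -- The chosen coordinate functionals span all of them, so a word on which they vanish is zero.
  have hsep : ∀ w : D, (∀ k, w.1 (a k) = 0) → w = 0 := by
    intro w hw
    have hle : Submodule.span (ZMod 2) (Set.range f) ≤
        LinearMap.ker (Module.Dual.eval (ZMod 2) D w) := by
      rw [← hspan, Submodule.span_le]
      rintro _ ⟨k, rfl⟩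
      simpa [f] using hw k
    ext i
    simpa [f] using hle (Submodule.subset_span ⟨i, rfl⟩)
  refine ⟨Finset.univ.map ⟨a, ha⟩, ?_, ?_⟩
  · rw [Finset.card_map, Finset.card_univ]
    apply le_antisymm
    · simpa using hli.fintype_card_le_finrank
    · let g : D →ₗ[ZMod 2] (κ → ZMod 2) := LinearMap.pi fun k => f (a k)
      have hg : Function.Injective g := by
        rw [injective_iff_map_eq_zero]
        exact fun w hw => hsep w fun k => congrFun hw k
      simpa using LinearMap.finrank_le_finrank_of_injective hg
  · intro u hu v hv huv
    have := hsep (⟨u, hu⟩ - ⟨v, hv⟩) fun k => by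
      simp [huv (a k) (by simp)]
    simpa [sub_eq_zero] using this

/-! ### Weights and even moments of transitive codes. -/

open scoped Classical in
/-- The words of weight `m` of a binary linear code. -/
noncomputable def weightClass {N : ℕ} (D : Submodule (ZMod 2) (Fin N → ZMod 2)) (m : ℕ) :
    Finset (Fin N → ZMod 2) := {v | v ∈ D ∧ hammingNorm v = m}

theorem mem_weightClass {N : ℕ} {D : Submodule (ZMod 2) (Fin N → ZMod 2)} {m : ℕ}
    {v : Fin N → ZMod 2} : v ∈ weightClass D m ↔ v ∈ D ∧ hammingNorm v = m := by
  simp [weightClass]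

theorem sum_binarySign_eq {N : ℕ} (v : Fin N → ZMod 2) :
    ∑ i, binarySign (v i) = N - 2 * hammingNorm v := by
  have h : ∀ i, binarySign (v i) = 1 - 2 * (if v i ≠ 0 then 1 else 0) := by
    intro i
    rcases zmod_two_eq_zero_or_one (v i) with h | h <;> simp [h]
    norm_num
  simp_rw [h, Finset.sum_sub_distrib, ← Finset.mul_sum, Finset.sum_boole]
  simp [hammingNorm]

theorem hammingNorm_comp_perm {N : ℕ} (v : Fin N → ZMod 2) (π : Equiv.Perm (Fin N)) :
    hammingNorm (fun k => v (π k)) = hammingNorm v := by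
  unfold hammingNorm
  exact Finset.card_equiv π (by simp)

/-- In a transitive code the words of a given weight have the same total sign on every
coordinate. -/
theorem sum_weightClass_binarySign_eq {N : ℕ} {D : Submodule (ZMod 2) (Fin N → ZMod 2)}
    (hD : IsTransitiveCode (D : Set (Fin N → ZMod 2))) (m : ℕ) (i j : Fin N) :
    ∑ v ∈ weightClass D m, binarySign (v i) = ∑ v ∈ weightClass D m, binarySign (v j) := by
  obtain ⟨π, hπ, h⟩ := hD i j
  symm
  have hinj : Function.Injective fun (v : Fin N → ZMod 2) k => v (π k) :=
    π.surjective.injective_comp_right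
  have hmaps : ∀ v ∈ weightClass D m, (fun k => v (π k)) ∈ weightClass D m := by
    intro v hv
    rw [mem_weightClass] at hv ⊢
    exact ⟨h v hv.1, by rw [hammingNorm_comp_perm, hv.2]⟩
  refine Finset.sum_bij (fun v _ k => v (π k)) hmaps (fun _ _ _ _ h => hinj h) ?_ ?_
  · intro u hu
    obtain ⟨v, hv, rfl⟩ := Finset.surj_on_of_inj_on_of_card_le (fun v _ k => v (π k)) hmaps
      (fun _ _ _ _ h => hinj h) le_rfl u hu
    exact ⟨v, hv, rfl⟩
  · intro v _
    simp [hπ]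

/-- Restriction to `I` is injective on `A`; enlarging its image to all of `F₂^I` makes the sum
factor over coordinates. -/
theorem sum_exp_binarySign_le {N : ℕ} (A : Finset (Fin N → ZMod 2)) (I : Finset (Fin N))
    (hI : ∀ u ∈ A, ∀ v ∈ A, (∀ i ∈ I, u i = v i) → u = v) (x : ℝ) :
    ∑ v ∈ A, Real.exp (x * ∑ i ∈ I, binarySign (v i)) ≤ (2 * Real.cosh x) ^ I.card := by
  have hcosh : 2 * Real.cosh x = ∑ b : ZMod 2, Real.exp (x * binarySign b) := by
    rw [Real.cosh_eq, show (Finset.univ : Finset (ZMod 2)) = {0, 1} from rfl,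
      Finset.sum_pair (by decide)]
    simp
    ring
  have hinj : Set.InjOn (fun (v : Fin N → ZMod 2) (i : I) => v i) A := by
    intro u hu v hv huv
    exact hI u hu v hv fun i hi => congrFun huv ⟨i, hi⟩
  calc ∑ v ∈ A, Real.exp (x * ∑ i ∈ I, binarySign (v i))
      = ∑ v ∈ A, ∏ i : I, Real.exp (x * binarySign (v i)) := by
        refine Finset.sum_congr rfl fun v _ => ?_
        rw [Finset.mul_sum, Real.exp_sum, ← Finset.prod_coe_sort]
    _ = ∑ u ∈ A.image fun v (i : I) => v i, ∏ i : I, Real.exp (x * binarySign (u i)) := by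
        rw [Finset.sum_image hinj]
    _ ≤ ∑ u : I → ZMod 2, ∏ i : I, Real.exp (x * binarySign (u i)) :=
        Finset.sum_le_sum_of_subset_of_nonneg (Finset.subset_univ _)
          fun u _ _ => Finset.prod_nonneg fun i _ => (Real.exp_pos _).le
    _ = (2 * Real.cosh x) ^ I.card := by
        have h := Finset.prod_univ_sum (fun _ : I => (Finset.univ : Finset (ZMod 2)))
          fun _ b => Real.exp (x * binarySign b)
        rw [Fintype.piFinset_univ] at h
        rw [hcosh, ← h]
        simp

/-- A bound on the weight distribution of transitive binary linear codes. -/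
theorem card_weightClass_mul_exp_le {N : ℕ} (hN : 0 < N)
    {D : Submodule (ZMod 2) (Fin N → ZMod 2)}
    (hD : IsTransitiveCode (D : Set (Fin N → ZMod 2))) (m : ℕ) :
    (weightClass D m).card *
        Real.exp (Module.finrank (ZMod 2) D * (((N - 2 * m) / N : ℝ) ^ 2 / 2)) ≤
      2 ^ Module.finrank (ZMod 2) D := by
  obtain ⟨I, hcard, hI⟩ := exists_information_set D
  set A := weightClass D m with hA
  set K := Module.finrank (ZMod 2) D
  set x : ℝ := (N - 2 * m) / N with hx
  have hN' : (0 : ℝ) < N := by exact_mod_cast hN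
  have hcoord : ∀ i, ∑ v ∈ A, binarySign (v i) = A.card * x := by
    intro i
    have h1 : ∑ j, ∑ v ∈ A, binarySign (v j) = N * ∑ v ∈ A, binarySign (v i) := by
      rw [Finset.sum_congr rfl fun j _ => sum_weightClass_binarySign_eq hD m j i]
      simp [hA]
    have h2 : ∑ j, ∑ v ∈ A, binarySign (v j) = A.card * (N - 2 * m) := by
      rw [Finset.sum_comm, Finset.sum_congr rfl fun v hv => ?_, Finset.sum_const, nsmul_eq_mul]
      rw [sum_binarySign_eq, (mem_weightClass.mp hv).2]
    rw [hx]
    field_simp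
    linarith
  -- Jensen's inequality: the exponent has mean `K x²` over `A`, and `1 + u ≤ exp u` is applied
  -- around that mean.
  have hlow : A.card * Real.exp (K * x ^ 2) ≤
      ∑ v ∈ A, Real.exp (x * ∑ i ∈ I, binarySign (v i)) := by
    calc (A.card : ℝ) * Real.exp (K * x ^ 2)
        = ∑ v ∈ A, Real.exp (K * x ^ 2) *
            (1 + (x * ∑ i ∈ I, binarySign (v i) - K * x ^ 2)) := by
          rw [← Finset.mul_sum, Finset.sum_add_distrib, Finset.sum_sub_distrib, ← Finset.mul_sum,
            Finset.sum_comm, Finset.sum_congr rfl fun i _ => hcoord i]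
          simp [hcard]
          ring
      _ ≤ _ := by
          refine Finset.sum_le_sum fun v _ => ?_
          have h := Real.add_one_le_exp (x * ∑ i ∈ I, binarySign (v i) - K * x ^ 2)
          calc _ ≤ Real.exp (K * x ^ 2) *
                Real.exp (x * ∑ i ∈ I, binarySign (v i) - K * x ^ 2) := by
                gcongr; linarith
            _ = _ := by rw [← Real.exp_add]; ring_nf
  have hup := sum_exp_binarySign_le A I (fun u hu v hv =>
    hI u (mem_weightClass.mp hu).1 v (mem_weightClass.mp hv).1) x
  have hcosh : (2 * Real.cosh x) ^ I.card ≤ 2 ^ K * Real.exp (K * (x ^ 2 / 2)) := by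
    rw [hcard, mul_pow, Real.exp_nat_mul]
    gcongr
    exact Real.cosh_le_exp_half_sq x
  have hexp : Real.exp (K * x ^ 2) = Real.exp (K * (x ^ 2 / 2)) * Real.exp (K * (x ^ 2 / 2)) := by
    rw [← Real.exp_add]; ring_nf
  have := (hlow.trans hup).trans hcosh
  rw [hexp, ← mul_assoc] at this
  exact le_of_mul_le_mul_right this (Real.exp_pos _)

/-- This is `t ^ w / w! ≤ exp t` at `t = K x² / 2`, matching the exponential in the weight bound. -/
theorem mul_pow_two_mul_le {K : ℝ} (hK : 0 < K) (a x : ℝ) (w : ℕ) :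
    (a * x) ^ (2 * w) ≤ a ^ (2 * w) * w.factorial * (2 / K) ^ w * Real.exp (K * (x ^ 2 / 2)) := by
  have h := Real.pow_div_factorial_le_exp (x := K * (x ^ 2 / 2)) (by positivity) w
  have hx : x ^ (2 * w) = (2 / K) ^ w * (K * (x ^ 2 / 2)) ^ w := by
    rw [pow_mul, ← mul_pow]
    congr 1
    field_simp
  rw [div_le_iff₀ (by positivity)] at h
  calc (a * x) ^ (2 * w) = a ^ (2 * w) * (2 / K) ^ w * (K * (x ^ 2 / 2)) ^ w := by
        rw [mul_pow, hx, mul_assoc]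
    _ ≤ a ^ (2 * w) * (2 / K) ^ w * (Real.exp (K * (x ^ 2 / 2)) * w.factorial) :=
        mul_le_mul_of_nonneg_left h
          (mul_nonneg (by rw [pow_mul]; positivity) (by positivity))
    _ = _ := by ring

theorem sum_code_pow_le {N : ℕ} (hN : 0 < N) {D : Submodule (ZMod 2) (Fin N → ZMod 2)}
    [Fintype D] (hD : IsTransitiveCode (D : Set (Fin N → ZMod 2)))
    (hK : 0 < Module.finrank (ZMod 2) D) (w : ℕ) :
    ∑ v : D, (∑ i, binarySign (v.1 i)) ^ (2 * w) ≤
      (N + 1) * 2 ^ Module.finrank (ZMod 2) D * (N : ℝ) ^ (2 * w) * w.factorial *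
        (2 / Module.finrank (ZMod 2) D) ^ w := by
  classical
  set K := Module.finrank (ZMod 2) D
  have hN' : (0 : ℝ) < N := by exact_mod_cast hN
  have hK' : (0 : ℝ) < K := by exact_mod_cast hK
  have hterm : ∀ m : ℕ, (weightClass D m).card * ((N : ℝ) - 2 * m) ^ (2 * w) ≤
      2 ^ K * (N : ℝ) ^ (2 * w) * w.factorial * (2 / K) ^ w := by
    intro m
    have h1 := card_weightClass_mul_exp_le hN hD m
    have h3 := mul_pow_two_mul_le hK' N ((N - 2 * m) / N) w
    rw [mul_div_cancel₀ _ hN'.ne'] at h3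
    set x : ℝ := (N - 2 * m) / N with hx
    calc _ ≤ ((weightClass D m).card : ℝ) *
          ((N : ℝ) ^ (2 * w) * w.factorial * (2 / K) ^ w * Real.exp (K * (x ^ 2 / 2))) := by
          gcongr
      _ = (weightClass D m).card * Real.exp (K * (x ^ 2 / 2)) *
          ((N : ℝ) ^ (2 * w) * w.factorial * (2 / K) ^ w) := by ring
      _ ≤ 2 ^ K * ((N : ℝ) ^ (2 * w) * w.factorial * (2 / K) ^ w) := by gcongr
      _ = _ := by ring
  calc ∑ v : D, (∑ i, binarySign (v.1 i)) ^ (2 * w)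
      = ∑ v : Fin N → ZMod 2 with v ∈ D, (∑ i, binarySign (v i)) ^ (2 * w) := by
        rw [Finset.sum_subtype (p := (· ∈ D)) {v : Fin N → ZMod 2 | v ∈ D} (fun v => by simp)]
    _ = ∑ m ∈ Finset.range (N + 1), ∑ v : Fin N → ZMod 2 with v ∈ D ∧ hammingNorm v = m,
          (∑ i, binarySign (v i)) ^ (2 * w) := by
        rw [← Finset.sum_fiberwise_of_maps_to (s := {v : Fin N → ZMod 2 | v ∈ D})
          (t := Finset.range (N + 1)) (g := hammingNorm)]
        · simp_rw [Finset.filter_filter]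
        · intro v _
          have := hammingNorm_le_card_fintype (x := v)
          simp at this ⊢
          omega
    _ = ∑ m ∈ Finset.range (N + 1), (weightClass D m).card * ((N : ℝ) - 2 * m) ^ (2 * w) := by
        refine Finset.sum_congr rfl fun m _ => ?_
        rw [← nsmul_eq_mul, ← Finset.sum_const]
        refine Finset.sum_congr (by ext; simp [mem_weightClass]) fun v hv => ?_
        rw [sum_binarySign_eq, (mem_weightClass.mp hv).2]
    _ ≤ ∑ m ∈ Finset.range (N + 1), 2 ^ K * (N : ℝ) ^ (2 * w) * w.factorial * (2 / K) ^ w :=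
        Finset.sum_le_sum fun m _ => hterm m
    _ = _ := by
        rw [Finset.sum_const, Finset.card_range, nsmul_eq_mul]; push_cast; ring

/-! ### Pairs of equal weight in a coset. -/

open scoped Classical in
/-- The number of words `y'` in the coset `y + C` with the same weight as `y`. -/
noncomputable def cosetWeightCount {N : ℕ} (C : Submodule (ZMod 2) (Fin N → ZMod 2))
    (y : Fin N → ZMod 2) : ℕ :=
  Finset.card {c : Fin N → ZMod 2 | c ∈ C ∧ hammingNorm (c + y) = hammingNorm y}

theorem sum_cosetWeightCount_mul_le {N : ℕ} (C : Submodule (ZMod 2) (Fin N → ZMod 2))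
    [Fintype (dualCode C)] (w : ℕ) :
    (∑ y : Fin N → ZMod 2 with hammingNorm y = w, (cosetWeightCount C y : ℝ)) *
        ((w.factorial : ℝ) ^ 2 * 2 ^ Module.finrank (ZMod 2) (dualCode C)) ≤
      ∑ v : dualCode C, (∑ i, binarySign (v.1 i)) ^ (2 * w) := by
  classical
  have hcard : ∀ y ∈ C, ∑ v : dualCode C, binarySign (v.1 ⬝ᵥ y) = 2 ^ Module.finrank (ZMod 2) (dualCode C) := by
    intro y hy
    have hD : (Fintype.card (dualCode C) : ℝ) = 2 ^ Module.finrank (ZMod 2) (dualCode C) := by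
      rw [Module.card_eq_pow_finrank (K := ZMod 2) (V := dualCode C), ZMod.card]; push_cast; rfl
    rw [← hD, Finset.sum_congr rfl fun v _ => by
      rw [dotProduct_comm, mem_dualCode.mp v.2 y hy, binarySign_zero]]
    simp
  have hexpand : ∑ v : dualCode C, (∑ i, binarySign (v.1 i)) ^ (2 * w) =
      ∑ y, ∑ z, basisTupleCount w y * basisTupleCount w z *
        ∑ v : dualCode C, binarySign (v.1 ⬝ᵥ (y + z)) := by
    simp_rw [two_mul, pow_add, sum_binarySign_pow, Finset.sum_mul_sum, Finset.mul_sum]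
    rw [Finset.sum_comm]
    refine Finset.sum_congr rfl fun y _ => ?_
    rw [Finset.sum_comm]
    refine Finset.sum_congr rfl fun z _ => Finset.sum_congr rfl fun v _ => ?_
    rw [dotProduct_add, binarySign_add]
    ring
  have hcount : ∀ y : Fin N → ZMod 2, hammingNorm y = w → (cosetWeightCount C y : ℝ) =
      ∑ z, if y + z ∈ C ∧ hammingNorm z = w then (1 : ℝ) else 0 := by
    intro y hy
    rw [Finset.sum_boole, cosetWeightCount]
    congr 1
    refine Finset.card_equiv (Equiv.addRight y) fun c => ?_
    have : y + (c + y) = c := by rw [add_comm c, ← add_assoc, binary_add_self, zero_add]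
    simp [this, hy]
  rw [hexpand, Finset.sum_mul, Finset.sum_filter]
  refine Finset.sum_le_sum fun y _ => ?_
  -- Nonnegative character sums allow discarding all pairs except those of weight `w` with `y + z ∈
  -- C`.
  have hnn : ∀ z, 0 ≤ basisTupleCount w y * basisTupleCount w z *
      ∑ v : dualCode C, binarySign (v.1 ⬝ᵥ (y + z)) := fun z =>
    mul_nonneg (mul_nonneg (basisTupleCount_nonneg _ _) (basisTupleCount_nonneg _ _))
      (sum_binarySign_nonneg _ _)
  split_ifs with hy
  · rw [hcount y hy, Finset.sum_mul]
    refine Finset.sum_le_sum fun z _ => ?_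
    split_ifs with hz
    · rw [hcard _ hz.1, one_mul, sq]
      gcongr
      · exact basisTupleCount_nonneg _ _
      · exact factorial_le_basisTupleCount w y hy
      · exact factorial_le_basisTupleCount w z hz.2
    · simpa using hnn z
  · exact Finset.sum_nonneg fun z _ => hnn z

theorem sum_cosetWeightCount_le {N : ℕ} (hN : 0 < N) {C : Submodule (ZMod 2) (Fin N → ZMod 2)}
    (hC : IsTransitiveCode (C : Set (Fin N → ZMod 2))) {δ : ℝ} (hδ : 0 < δ)
    (hdim : (Module.finrank (ZMod 2) (dualCode C) : ℝ) = δ * N) {w : ℕ} (hw : 4 * w ≤ 3 * N) :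
    ∑ y : Fin N → ZMod 2 with hammingNorm y = w, (cosetWeightCount C y : ℝ) ≤
      (N + 1) * N.choose w * (8 / δ) ^ w := by
  classical
  have hN' : (0 : ℝ) < N := by exact_mod_cast hN
  have hK : 0 < Module.finrank (ZMod 2) (dualCode C) := by
    have : (0 : ℝ) < Module.finrank (ZMod 2) (dualCode C) := by rw [hdim]; positivity
    exact_mod_cast this
  have h := (sum_cosetWeightCount_mul_le C w).trans (sum_code_pow_le hN hC.dualCode hK w)
  set P := ∑ y : Fin N → ZMod 2 with hammingNorm y = w, (cosetWeightCount C y : ℝ)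
  rw [hdim] at h
  have hf : (0 : ℝ) < w.factorial := by positivity
  -- Since `w ≤ 3N/4`, each factor of the falling factorial is at least `N/4`; this turns `2/δ` into
  -- `8/δ`.
  have hchoose : (N : ℝ) ^ w ≤ 4 ^ w * (N.choose w * w.factorial) := by
    have h1 := Nat.pow_le_choose (α := ℝ) w N
    rw [div_le_iff₀ hf] at h1
    calc (N : ℝ) ^ w ≤ (4 * (N + 1 - w : ℕ)) ^ w := by
          gcongr
          have : N ≤ 4 * (N + 1 - w) := by omega
          exact_mod_cast this
      _ = 4 ^ w * ((N + 1 - w : ℕ) : ℝ) ^ w := mul_pow _ _ _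
      _ ≤ _ := by gcongr
  have hmain : P * w.factorial ≤ (N + 1) * N ^ w * (2 / δ) ^ w := by
    have h2 : (N : ℝ) ^ (2 * w) * (2 / (δ * N)) ^ w = N ^ w * (2 / δ) ^ w := by
      rw [two_mul, pow_add, mul_assoc, ← mul_pow (N : ℝ) (2 / (δ * N))]
      congr 2
      field_simp
    refine le_of_mul_le_mul_right ?_
      (show (0 : ℝ) < w.factorial * 2 ^ Module.finrank (ZMod 2) (dualCode C) by positivity)
    calc _ = P * ((w.factorial : ℝ) ^ 2 * 2 ^ Module.finrank (ZMod 2) (dualCode C)) := by ring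
      _ ≤ _ := h
      _ = (N + 1) * ((N : ℝ) ^ (2 * w) * (2 / (δ * N)) ^ w) *
          (w.factorial * 2 ^ Module.finrank (ZMod 2) (dualCode C)) := by ring
      _ = _ := by rw [h2]; ring
  refine le_of_mul_le_mul_right ?_ hf
  calc P * w.factorial ≤ (N + 1) * N ^ w * (2 / δ) ^ w := hmain
    _ ≤ (N + 1) * (4 ^ w * (N.choose w * w.factorial)) * (2 / δ) ^ w := by gcongr
    _ = (N + 1) * N.choose w * (4 * (2 / δ)) ^ w * w.factorial := by rw [mul_pow]; ring
    _ = _ := by rw [show 4 * (2 / δ) = 8 / δ by ring]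

/-! ### Tail bounds for the noise. -/

theorem noisyDist_nonneg {N : ℕ} {ε : ℝ} (h0 : 0 ≤ ε) (h1 : ε ≤ 1) (z : Fin N → ZMod 2) :
    0 ≤ noisyDist ε z :=
  mul_nonneg (pow_nonneg h0 _) (pow_nonneg (sub_nonneg.mpr h1) _)

theorem sum_noisyDist_mul_exp {N : ℕ} (ε t : ℝ) :
    ∑ z : Fin N → ZMod 2, noisyDist ε z * Real.exp (t * hammingNorm z) =
      (1 - ε + ε * Real.exp t) ^ N := by
  have hprod : ∀ z : Fin N → ZMod 2, noisyDist ε z * Real.exp (t * hammingNorm z) =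
      ∏ i, if z i = 0 then 1 - ε else ε * Real.exp t := by
    intro z
    have hcard : Finset.card {i | z i = 0} = N - hammingNorm z := by
      have := Finset.card_filter_add_card_filter_not (s := Finset.univ) (fun i => z i = 0)
      rw [Finset.card_univ, Fintype.card_fin] at this
      change _ + hammingNorm z = N at this
      omega
    rw [Finset.prod_ite, Finset.prod_const, Finset.prod_const, hcard, mul_pow, ← Real.exp_nat_mul,
      noisyDist, mul_comm t]
    change _ = _ * (ε ^ hammingNorm z * Real.exp (hammingNorm z * t))
    ring
  have h := Finset.prod_univ_sum (fun _ : Fin N => (Finset.univ : Finset (ZMod 2)))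
    fun _ b => if b = 0 then 1 - ε else ε * Real.exp t
  rw [Fintype.piFinset_univ] at h
  simp_rw [hprod]
  rw [← h, show (Finset.univ : Finset (ZMod 2)) = {0, 1} from rfl, Finset.prod_const,
    Finset.sum_pair (by decide)]
  simp

/-- A Chernoff bound for the upper tail of the weight of the noise. -/
theorem noisyProb_lt_hammingNorm_le {N : ℕ} {ε s : ℝ} (h0 : 0 < ε) (h1 : ε ≤ 1) (hN : 0 < N)
    (hs : 0 ≤ s) (hs1 : s ≤ ε * N) :
    noisyProb ε {z : Fin N → ZMod 2 | ε * N + s < hammingNorm z} ≤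
      Real.exp (-(s ^ 2 / (3 * ε * N))) := by
  have hN' : (0 : ℝ) < N := by exact_mod_cast hN
  -- The minimizer of `(3/4) ε N t² - t s`, the exponent left after the quadratic bound on `exp t`.
  set t : ℝ := 2 / 3 * (s / (ε * N)) with ht
  have hq : s / (ε * N) ≤ 1 := (div_le_one (by positivity)).mpr hs1
  have ht0 : 0 ≤ t := by positivity
  have ht1 : t ≤ 1 := by linarith
  have hexp : Real.exp t ≤ 1 + t + 3 / 4 * t ^ 2 := by
    have h := Real.exp_bound' ht0 ht1 (n := 2) (by norm_num)
    norm_num [Finset.sum_range_succ] at h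
    linarith
  have hmgf : (1 - ε + ε * Real.exp t) ^ N ≤ Real.exp (N * (ε * (t + 3 / 4 * t ^ 2))) := by
    rw [Real.exp_nat_mul]
    have h2 : 1 - ε + ε * Real.exp t ≤ Real.exp (ε * (t + 3 / 4 * t ^ 2)) := by
      have h3 := Real.add_one_le_exp (ε * (t + 3 / 4 * t ^ 2))
      nlinarith
    have h4 : 0 ≤ 1 - ε + ε * Real.exp t := by
      have := Real.exp_pos t
      have : 0 ≤ ε * Real.exp t := by positivity
      linarith
    gcongr
  calc noisyProb ε {z : Fin N → ZMod 2 | ε * N + s < hammingNorm z}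
      ≤ ∑ z : Fin N → ZMod 2, noisyDist ε z * Real.exp (t * hammingNorm z) *
          Real.exp (-(t * (ε * N + s))) := by
        refine Finset.sum_le_sum fun z _ => ?_
        have hz := noisyDist_nonneg h0.le h1 z
        by_cases hmem : z ∈ {z : Fin N → ZMod 2 | ε * N + s < hammingNorm z}
        · rw [Set.indicator_of_mem hmem, mul_assoc, ← Real.exp_add]
          refine le_mul_of_one_le_right hz (Real.one_le_exp ?_)
          have : ε * N + s < hammingNorm z := hmem
          nlinarith
        · rw [Set.indicator_of_notMem hmem]
          positivity
    _ ≤ Real.exp (N * (ε * (t + 3 / 4 * t ^ 2))) * Real.exp (-(t * (ε * N + s))) := by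
        rw [← Finset.sum_mul, sum_noisyDist_mul_exp]
        gcongr
    _ = _ := by
        rw [← Real.exp_add, ht]
        congr 1
        field_simp
        ring

/-- Markov's inequality for the number of words of a coset with the weight of the noise. -/
theorem noisyProb_cosetWeightCount_le {N : ℕ} {ε B M r : ℝ} (h0 : 0 ≤ ε) (h1 : ε ≤ 1)
    (hB : 0 < B) (hM : 0 ≤ M) (C : Submodule (ZMod 2) (Fin N → ZMod 2))
    (hC : ∀ w : ℕ, (w : ℝ) ≤ r →
      ∑ y : Fin N → ZMod 2 with hammingNorm y = w, (cosetWeightCount C y : ℝ) ≤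
        N.choose w * M) :
    noisyProb ε {z | (hammingNorm z : ℝ) ≤ r ∧ B < cosetWeightCount C z} ≤ M / B := by
  have h1' : 0 ≤ 1 - ε := sub_nonneg.mpr h1
  calc noisyProb ε {z | (hammingNorm z : ℝ) ≤ r ∧ B < cosetWeightCount C z}
      ≤ ∑ z : Fin N → ZMod 2, if (hammingNorm z : ℝ) ≤ r then
          noisyDist ε z * (cosetWeightCount C z / B) else 0 := by
        refine Finset.sum_le_sum fun z _ => ?_
        have hz := noisyDist_nonneg h0 h1 z
        by_cases hmem : z ∈ {z | (hammingNorm z : ℝ) ≤ r ∧ B < cosetWeightCount C z}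
        · rw [Set.indicator_of_mem hmem, if_pos hmem.1]
          exact le_mul_of_one_le_right hz ((one_le_div hB).mpr hmem.2.le)
        · rw [Set.indicator_of_notMem hmem]
          split_ifs <;> positivity
    _ = ∑ w ∈ Finset.range (N + 1), ∑ z : Fin N → ZMod 2 with hammingNorm z = w,
          if (hammingNorm z : ℝ) ≤ r then
            noisyDist ε z * (cosetWeightCount C z / B) else 0 := by
        refine (Finset.sum_fiberwise_of_maps_to (fun z _ => ?_) _).symm
        have := hammingNorm_le_card_fintype (x := z)
        simp at this ⊢
        omega
    -- The noise is uniform on each sphere, so binomial probabilities appear and sum to `1`.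
    _ ≤ ∑ w ∈ Finset.range (N + 1), ε ^ w * (1 - ε) ^ (N - w) * N.choose w * (M / B) := by
        refine Finset.sum_le_sum fun w _ => ?_
        by_cases hw : (w : ℝ) ≤ r
        · calc _ = ∑ z : Fin N → ZMod 2 with hammingNorm z = w,
                ε ^ w * (1 - ε) ^ (N - w) / B * cosetWeightCount C z := by
                refine Finset.sum_congr rfl fun z hz => ?_
                have hz' : hammingNorm z = w := by simpa using hz
                rw [hz', if_pos hw, noisyDist, hz']
                ring
            _ ≤ ε ^ w * (1 - ε) ^ (N - w) / B * (N.choose w * M) := by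
                rw [← Finset.mul_sum]
                gcongr
                exact hC w hw
            _ = _ := by ring
        · rw [Finset.sum_eq_zero fun z hz => ?_]
          · positivity
          · have hz' : hammingNorm z = w := by simpa using hz
            rw [hz', if_neg hw]
    _ = M / B := by
        rw [← Finset.sum_mul, ← add_pow]
        simp

/-! ### The decoder and the theorem. -/

open scoped Classical in
/-- The codewords `c` at distance at most `r` from `x` for which at most `B` codewords have the
same distance from `x` as `c`. -/
noncomputable def thinSphereDecoder {N : ℕ} (C : Submodule (ZMod 2) (Fin N → ZMod 2)) (r B : ℝ)
    (x : Fin N → ZMod 2) : Finset (Fin N → ZMod 2) :=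
  {c | c ∈ C ∧ (hammingNorm (c + x) : ℝ) ≤ r ∧ (cosetWeightCount C (c + x) : ℝ) ≤ B}

theorem mem_thinSphereDecoder {N : ℕ} {C : Submodule (ZMod 2) (Fin N → ZMod 2)} {r B : ℝ}
    {x c : Fin N → ZMod 2} : c ∈ thinSphereDecoder C r B x ↔
      c ∈ C ∧ (hammingNorm (c + x) : ℝ) ≤ r ∧ (cosetWeightCount C (c + x) : ℝ) ≤ B := by
  simp [thinSphereDecoder]

theorem card_thinSphereDecoder_le {N : ℕ} (C : Submodule (ZMod 2) (Fin N → ZMod 2)) (r : ℝ)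
    {B : ℝ} (hB : 0 ≤ B) (x : Fin N → ZMod 2) :
    ((thinSphereDecoder C r B x).card : ℝ) ≤ (N + 1) * B := by
  classical
  set T := thinSphereDecoder C r B x
  have hfib : ∀ m, (Finset.card {c ∈ T | hammingNorm (c + x) = m} : ℝ) ≤ B := by
    intro m
    rcases Finset.eq_empty_or_nonempty {c ∈ T | hammingNorm (c + x) = m} with he | ⟨b, hb⟩
    · simpa [he] using hB
    · obtain ⟨hbT, hbm⟩ := Finset.mem_filter.mp hb
      obtain ⟨hbC, -, hbB⟩ := mem_thinSphereDecoder.mp hbT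
      refine le_trans ?_ hbB
      rw [cosetWeightCount, Nat.cast_le]
      -- Adding one listed codeword `b` at distance `m` sends the others into the set counted by
      -- `cosetWeightCount C (b + x)`.
      refine Finset.card_le_card_of_injOn (· + b) ?_ (add_left_injective b).injOn
      intro c hc
      obtain ⟨hcT, hcm⟩ := Finset.mem_filter.mp hc
      have hadd : c + b + (b + x) = c + x := by
        rw [add_assoc, ← add_assoc b, binary_add_self, zero_add]
      simp [C.add_mem (mem_thinSphereDecoder.mp hcT).1 hbC, hadd, hcm, hbm]
  rw [Finset.card_eq_sum_card_fiberwise (f := fun c => hammingNorm (c + x))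
    (t := Finset.range (N + 1))]
  · push_cast
    calc _ ≤ ∑ m ∈ Finset.range (N + 1), B := Finset.sum_le_sum fun m _ => hfib m
      _ = _ := by simp
  · intro c _
    have := hammingNorm_le_card_fintype (x := c + x)
    simp at this ⊢
    omega

theorem noisyProb_le_add {N : ℕ} {ε : ℝ} (h0 : 0 ≤ ε) (h1 : ε ≤ 1)
    {E F G : Set (Fin N → ZMod 2)} (h : E ⊆ F ∪ G) :
    noisyProb ε E ≤ noisyProb ε F + noisyProb ε G := by
  unfold noisyProb
  rw [← Finset.sum_add_distrib]
  refine Finset.sum_le_sum fun z _ => ?_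
  have hz := noisyDist_nonneg h0 h1 z
  have hF : 0 ≤ F.indicator (noisyDist ε) z :=
    Set.indicator_nonneg (fun _ _ => noisyDist_nonneg h0 h1 _) z
  have hG : 0 ≤ G.indicator (noisyDist ε) z :=
    Set.indicator_nonneg (fun _ _ => noisyDist_nonneg h0 h1 _) z
  by_cases hE : z ∈ E
  · rw [Set.indicator_of_mem hE]
    rcases h hE with hzF | hzG
    · rw [Set.indicator_of_mem hzF]; linarith
    · rw [Set.indicator_of_mem hzG]; linarith
  · rw [Set.indicator_of_notMem hE]; linarith

theorem theorem2 (ε η : ℝ) (hε : ε ∈ Set.Ioo (0 : ℝ) (1 / 2)) (hη : η ∈ Set.Ioo (0 : ℝ) 1)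
    (N : ℕ) (hN : (5 / ε) ^ 20 < (N : ℝ))
    (C : Submodule (ZMod 2) (Fin N → ZMod 2))
    (hC : IsTransitiveCode (C : Set (Fin N → ZMod 2)))
    (hdim : (Module.finrank (ZMod 2) C : ℝ) = η * (N : ℝ)) :
    ∃ T : (Fin N → ZMod 2) → Finset (Fin N → ZMod 2),
      (∀ x, (T x : Set (Fin N → ZMod 2)) ⊆ (C : Set (Fin N → ZMod 2))) ∧
      (∀ x, ((T x).card : ℝ) ≤
        (N : ℝ) ^ 7 *
          (2 : ℝ) ^ ((ε * (N : ℝ) + (N : ℝ) ^ (3 / 4 : ℝ)) *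
            Real.logb 2 (Real.exp 4 / (1 - η)))) ∧
      ∀ c ∈ C, noisyProb ε {ρ | c ∉ T (c + ρ)} ≤
        Real.exp (-(√(N : ℝ) / (3 * ε))) + 1 / √(N : ℝ) := by
  obtain ⟨hε0, hε1⟩ := hε
  obtain ⟨hη0, hη1⟩ := hη
  have hδ : 0 < 1 - η := by linarith
  have hε1' : ε ≤ 1 := by linarith
  have hNr : (0 : ℝ) < N := lt_trans (by positivity) hN
  have hN0 : 0 < N := by exact_mod_cast hNr
  have hdual : (Module.finrank (ZMod 2) (dualCode C) : ℝ) = (1 - η) * N := by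
    have : (Module.finrank (ZMod 2) C : ℝ) + Module.finrank (ZMod 2) (dualCode C) = N := by
      exact_mod_cast finrank_add_finrank_dualCode C
    linarith
  -- Write `N = q ^ 4`.
  obtain ⟨q, hq0, hqN⟩ : ∃ q : ℝ, 0 < q ∧ q ^ 4 = N :=
    ⟨(N : ℝ) ^ (1 / 4 : ℝ), by positivity, by
      rw [← Real.rpow_natCast, ← Real.rpow_mul hNr.le]; norm_num⟩
  have hsqrt : √(N : ℝ) = q ^ 2 := by
    rw [← hqN, show q ^ 4 = (q ^ 2) ^ 2 by ring, Real.sqrt_sq (by positivity)]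
  have hroot : (N : ℝ) ^ (3 / 4 : ℝ) = q ^ 3 := by
    rw [← hqN, ← Real.rpow_natCast q 4, ← Real.rpow_mul hq0.le, ← Real.rpow_natCast q 3]
    norm_num
  have h10 : 10 ≤ 5 / ε := by rw [le_div_iff₀ hε0]; linarith
  -- This gives `N^(3/4) ≤ ε N`, as the Chernoff bound needs, and with `10 ≤ 5 / ε` also `r ≤ 3N/4`.
  have hq : 5 / ε < q := by
    have h20 : (5 / ε) ^ 20 = ((5 / ε) ^ 5) ^ 4 := by ring
    rw [h20, ← hqN] at hN
    exact (le_self_pow₀ (by linarith) (by norm_num)).trans_lt (lt_of_pow_lt_pow_left₀ 4 hq0.le hN)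
  have hεq : 5 < q * ε := (div_lt_iff₀ hε0).mp hq
  rw [hsqrt, hroot]
  set r : ℝ := ε * N + q ^ 3 with hr
  have hr0 : 0 < r := by positivity
  have hrN : 4 * r ≤ 3 * N := by
    rw [hr, ← hqN]
    have : q ^ 3 * 10 ≤ q ^ 3 * q := by gcongr; linarith
    have : ε * q ^ 4 ≤ 1 / 2 * q ^ 4 := by gcongr
    nlinarith
  have h8 : 1 ≤ 8 / (1 - η) := by rw [le_div_iff₀ hδ]; linarith
  set M : ℝ := (N + 1) * (8 / (1 - η)) ^ r with hM
  have hM0 : 0 < M := by positivity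
  -- The threshold exceeds the mean bound `M` by `√N = q ^ 2`, so Markov's inequality loses exactly
  -- `1 / √N`.
  refine ⟨thinSphereDecoder C r (q ^ 2 * M), fun x c hc => ?_, fun x => ?_, fun c hc => ?_⟩
  · exact (mem_thinSphereDecoder.mp hc).1
  · refine (card_thinSphereDecoder_le C r (by positivity) x).trans ?_
    have hpow : (2 : ℝ) ^ (r * Real.logb 2 (Real.exp 4 / (1 - η))) =
        (Real.exp 4 / (1 - η)) ^ r := by
      rw [mul_comm, Real.rpow_mul (by norm_num), Real.rpow_logb (by norm_num) (by norm_num)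
        (by positivity)]
    have hexp : (8 : ℝ) ≤ Real.exp 4 := by
      rw [show (4 : ℝ) = (4 : ℕ) * 1 by norm_num, Real.exp_nat_mul]
      have h2 : (2 : ℝ) ≤ Real.exp 1 := by linarith [Real.add_one_le_exp 1]
      calc (8 : ℝ) ≤ 2 ^ 4 := by norm_num
        _ ≤ _ := by gcongr
    have hN2 : (2 : ℝ) ≤ N := by
      have : (1 : ℝ) ≤ q ^ 3 := one_le_pow₀ (by linarith)
      rw [← hqN]
      nlinarith
    have hqle : q ^ 2 ≤ N := by
      rw [← hqN]
      exact pow_le_pow_right₀ (by linarith) (by norm_num)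
    have hN1 : (N : ℝ) + 1 ≤ N ^ 2 := by nlinarith
    rw [hpow, hM]
    calc ((N : ℝ) + 1) * (q ^ 2 * ((N + 1) * (8 / (1 - η)) ^ r))
        ≤ (N : ℝ) ^ 2 * (N * (N ^ 2 * (Real.exp 4 / (1 - η)) ^ r)) := by gcongr
      _ = (N : ℝ) ^ 5 * (Real.exp 4 / (1 - η)) ^ r := by ring
      _ ≤ _ := by
          gcongr
          · linarith
          · norm_num
  · have hsub : {ρ | c ∉ thinSphereDecoder C r (q ^ 2 * M) (c + ρ)} ⊆
        {z | r < hammingNorm z} ∪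
          {z | (hammingNorm z : ℝ) ≤ r ∧ q ^ 2 * M < cosetWeightCount C z} := by
      intro ρ hρ
      have hadd : c + (c + ρ) = ρ := by rw [← add_assoc, binary_add_self, zero_add]
      by_contra hcon
      simp only [Set.mem_union, Set.mem_ofPred_eq, not_or, not_and, not_lt] at hcon
      refine hρ (mem_thinSphereDecoder.mpr ?_)
      rw [hadd]
      exact ⟨hc, hcon.1, hcon.2 hcon.1⟩
    refine (noisyProb_le_add hε0.le hε1' hsub).trans (add_le_add ?_ ?_)
    · refine (noisyProb_lt_hammingNorm_le hε0 hε1' hN0 (by positivity) ?_).trans_eq ?_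
      · rw [← hqN]
        have : q ^ 3 * 1 ≤ q ^ 3 * (q * ε) := by gcongr; linarith
        linarith
      · rw [← hqN]
        congr 2
        field_simp
    · refine (noisyProb_cosetWeightCount_le (M := M) hε0.le hε1' (by positivity) hM0.le C
        fun w hw => ?_).trans_eq ?_
      · have hw' : 4 * w ≤ 3 * N := by
          have : 4 * (w : ℝ) ≤ 3 * N := by linarith
          exact_mod_cast this
        refine (sum_cosetWeightCount_le hN0 hC hδ hdual hw').trans ?_
        have : (8 / (1 - η)) ^ w ≤ (8 / (1 - η)) ^ r := by
          rw [← Real.rpow_natCast]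
          exact Real.rpow_le_rpow_of_exponent_le h8 hw
        calc _ ≤ (N + 1) * (N.choose w : ℝ) * (8 / (1 - η)) ^ r := by gcongr
          _ = _ := by rw [hM]; ring
      · field_simp
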